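/- For a real vector $x=(x_1,\dots,x_k)$ let $x^{\downarrow}$ and $x^{\uparrow}$ be its descending and ascending rearrangements. For $x,y\in\mathbb R^k$ write $x\prec_w y$ ($x$ is weakly (sub-)majorized by $y$) if $\sum_{i=1}^j x_i^{\downarrow}\le\sum_{i=1}^j y_i^{\downarrow}$ for every $1\le j\le k$; functions, absolute values and $\le$ are applied to vectors component-wise. Let $\lambda(\cdot)$ denote the vector of eigenvalues of a Hermitian matrix and $s(\cdot)$ the vector of singular values of a matrix, both with multiplicity and in descending order, and for a Hermitian $n\times n$ matrix $A$ let $\mathrm{spr}(A)=\lambda_1(A)-\lambda_n(A)$. Let $A$ be a Hermitian $n\times n$ complex matrix, let $\mathcal X,\mathcal Y\subseteq\mathbb C^n$ be subspaces of the same dimension $k$, and let $X,Y\in\mathbb C^{n\times k}$ be matrices whose columns form orthonormal bases of $\mathcal X$ and $\mathcal Y$, respectively. Let $\theta=\theta(\mathcal X,\mathcal Y)\in[0,\pi/2]^k$ be the descending vector of principal angles between $\mathcal X$ and $\mathcal Y$, defined by $\cos\theta=s^{\uparrow}(X^HY)$. Assume that $\mathcal X$ or $\mathcal Y$ is $A$-invariant.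 Then $$|\lambda(X^HAX)-\lambda(Y^HAY)|\;\prec_w\;\mathrm{spr}(A)\Big[\sin^2\theta+\tfrac12\sin^4\theta\Big]\;\le\;\tfrac32\,\mathrm{spr}(A)\,\sin^2\theta .$$ In particular, $|\lambda(X^HAX)-\lambda(Y^HAY)|\prec_w\tfrac32\,\mathrm{spr}(A)\sin^2\theta$. -/

import Mathlib

open scoped Matrix

namespace RitzMajorization

noncomputable section

/-- `x↓`: the entries of the real vector `x` rearranged in descending order
(`Tuple.sort x` sorts in ascending order, `Fin.rev` reverses the positions). -/
def sortDesc {m : ℕ} (x : Fin m → ℝ) : Fin m → ℝ :=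
  fun i => x (Tuple.sort x (Fin.rev i))

/-- Weak (sub-)majorization `x ≺_w y` of real vectors: the sum of the `j` largest entries of `x` is
at most the sum of the `j` largest entries of `y`, for every `j = 1, …, m`. -/
def WeaklyMajorized {m : ℕ} (x y : Fin m → ℝ) : Prop :=
  ∀ j : Fin m, ∑ i ∈ Finset.Iic j, sortDesc x i ≤ ∑ i ∈ Finset.Iic j, sortDesc y i

/-- `λ(A)`: the eigenvalues of a Hermitian matrix, with multiplicity, in descending order
(the entry with index `0` is the largest one). -/
def eigDesc {m : ℕ} {A : Matrix (Fin m) (Fin m) ℂ} (hA : A.IsHermitian) : Fin m → ℝ :=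
  fun i => hA.eigenvalues₀ (Fin.cast (Fintype.card_fin m).symm i)

/-- The spread `spr(A) = λ₁(A) - λ_n(A)` of the spectrum of a Hermitian matrix
(set to `0` for the empty matrix). -/
def spread {n : ℕ} {A : Matrix (Fin n) (Fin n) ℂ} (hA : A.IsHermitian) : ℝ :=
  if h : 0 < n then eigDesc hA ⟨0, h⟩ - eigDesc hA ⟨n - 1, Nat.sub_lt h Nat.one_pos⟩ else 0

/-- `s(B)`: the singular values of a square matrix, with multiplicity, in descending order. -/
def singDesc {m : ℕ} (B : Matrix (Fin m) (Fin m) ℂ) : Fin m → ℝ :=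
  fun i => (Matrix.toEuclideanLin B).singularValues i

/-- The columns of `X` form an orthonormal basis of the subspace `S` of `ℂⁿ`
(for the standard scalar product `vᴴ w`). -/
def IsOrthonormalBasisMatrix {n k : ℕ} (X : Matrix (Fin n) (Fin k) ℂ)
    (S : Submodule ℂ (Fin n → ℂ)) : Prop :=
  Xᴴ * X = 1 ∧ LinearMap.range X.mulVecLin = S

/-- The subspace `S` of `ℂⁿ` is `A`-invariant. -/
def IsInvariantUnder {n : ℕ} (A : Matrix (Fin n) (Fin n) ℂ) (S : Submodule ℂ (Fin n → ℂ)) : Prop :=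
  ∀ v ∈ S, A *ᵥ v ∈ S

/-- The vector `θ(𝒳, 𝒴)` of principal angles, in descending order, between two subspaces of the
same dimension with orthonormal bases given by the columns of `X` and of `Y`: the angles in
`[0, π/2]` with `cos θ(𝒳, 𝒴) = s↑(Xᴴ Y)`. -/
def principalAngles {n k : ℕ} (X Y : Matrix (Fin n) (Fin k) ℂ) : Fin k → ℝ :=
  fun i => Real.arccos (singDesc (Xᴴ * Y) (Fin.rev i))

end

end RitzMajorization

open RitzMajorization

namespace RitzMajorization

open Matrix
open scoped Matrix.Norms.L2Operator

variable {m n k : ℕ}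

/-! By symmetry let the span of `X` be invariant. A singular value decomposition of `Xᴴ Y` rotates
both bases, without changing the spectra in question, so that `Xᴴ Y = C` is diagonal with the
cosines `c i` ascending. Write `Y = X C + Z Q`, where `Q` is the diagonal of sines `q i` and `Z` is
a contraction with columns orthogonal to those of `X`. Replace `A` by `B = A - μ` with `μ` the
midpoint of the extreme eigenvalues, so `‖B‖ ≤ h = spr(A)/2`. Invariance kills the cross terms, and
the difference of the two compressions is `(C a C - a) + Q b Q` with `a = Xᴴ B X`, `b = Zᴴ B Z` of
norm at most `h`.

To bound a sum of `j + 1` eigenvalue gaps, truncate cosines and sines at their values at `j`. The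
truncated difference is small in operator norm, so Weyl's inequality charges each gap at most `h (2
(1 - c j) + q j ^ 2)`. The remainder is a sum of two Schur multiples of `a` and `b`, whose
trace-norm cost is controlled by `exists_majorant_of_multiplier`. Both costs add up exactly to `∑ i
≤ j, h (2 (1 - c i) + q i ^ 2)`, and a scalar inequality in `c i` turns this into the sine bound. -/

/-! ### Quadratic forms and ordered spectra. -/

/-- The real part of the quadratic form `xᴴ M x`. -/
def quad (M : Matrix (Fin m) (Fin m) ℂ) (x : Fin m → ℂ) : ℝ := (star x ⬝ᵥ (M *ᵥ x)).re

lemma quad_add (M N : Matrix (Fin m) (Fin m) ℂ) (x : Fin m → ℂ) :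
    quad (M + N) x = quad M x + quad N x := by
  simp [quad, add_mulVec, dotProduct_add]

lemma quad_sub (M N : Matrix (Fin m) (Fin m) ℂ) (x : Fin m → ℂ) :
    quad (M - N) x = quad M x - quad N x := by
  simp [quad, sub_mulVec, dotProduct_sub]

lemma quad_real_smul (r : ℝ) (M : Matrix (Fin m) (Fin m) ℂ) (x : Fin m → ℂ) :
    quad ((r : ℂ) • M) x = r * quad M x := by
  simp [quad, smul_mulVec, dotProduct_smul]

lemma quad_one (x : Fin m → ℂ) : quad 1 x = ∑ i, ‖x i‖ ^ 2 := by
  simp only [quad, one_mulVec, dotProduct, Complex.re_sum]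
  refine Finset.sum_congr rfl fun i _ => ?_
  rw [Pi.star_apply, Complex.star_def, ← Complex.normSq_eq_conj_mul_self, Complex.ofReal_re,
    Complex.normSq_eq_norm_sq]

lemma exists_eigenbasis {A : Matrix (Fin m) (Fin m) ℂ} (hA : A.IsHermitian) :
    ∃ v : OrthonormalBasis (Fin m) ℂ (EuclideanSpace ℂ (Fin m)),
      ∀ i, A *ᵥ (v i).ofLp = (eigDesc hA i : ℂ) • (v i).ofLp := by
  let e : Fin m ≃ Fin m := (Fintype.equivOfCardEq (Fintype.card_fin _)).symm.trans
    (finCongr (Fintype.card_fin m))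
  refine ⟨hA.eigenvectorBasis.reindex e, fun i => ?_⟩
  rw [OrthonormalBasis.reindex_apply, hA.mulVec_eigenvectorBasis]
  have : hA.eigenvalues (e.symm i) = eigDesc hA i := by
    simp [IsHermitian.eigenvalues, eigDesc, e]
  rw [this]
  rfl

lemma quad_eq_sum {A : Matrix (Fin m) (Fin m) ℂ} {l : Fin m → ℝ}
    {v : OrthonormalBasis (Fin m) ℂ (EuclideanSpace ℂ (Fin m))}
    (hv : ∀ i, A *ᵥ (v i).ofLp = (l i : ℂ) • (v i).ofLp) (u : EuclideanSpace ℂ (Fin m)) :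
    quad A u.ofLp = ∑ i, l i * ‖inner ℂ (v i) u‖ ^ 2 := by
  have h1 : A *ᵥ u.ofLp = ∑ i, (inner ℂ (v i) u * l i) • (v i).ofLp := by
    conv_lhs => rw [← v.sum_repr' u]
    rw [WithLp.ofLp_sum, mulVec_sum]
    refine Finset.sum_congr rfl fun i _ => ?_
    rw [WithLp.ofLp_smul, mulVec_smul, hv, smul_smul]
  have h2 : ∀ i, star u.ofLp ⬝ᵥ (v i).ofLp = star (inner ℂ (v i) u) := by
    intro i
    rw [EuclideanSpace.inner_eq_star_dotProduct, star_dotProduct, dotProduct_comm]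
  rw [quad, h1, dotProduct_sum, Complex.re_sum]
  refine Finset.sum_congr rfl fun i _ => ?_
  rw [dotProduct_smul, h2, smul_eq_mul, mul_right_comm, Complex.star_def, Complex.mul_conj,
    ← Complex.ofReal_mul, Complex.ofReal_re, Complex.normSq_eq_norm_sq, mul_comm]

lemma eigDesc_antitone {A : Matrix (Fin m) (Fin m) ℂ} (hA : A.IsHermitian) :
    Antitone (eigDesc hA) := fun _ _ h => hA.eigenvalues₀_antitone h

lemma sum_eigDesc {A : Matrix (Fin m) (Fin m) ℂ} (hA : A.IsHermitian) :
    ∑ i, eigDesc hA i = A.trace.re := by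
  rw [hA.trace_eq_sum_eigenvalues, Complex.re_sum]
  symm
  let e : Fin m ≃ Fin m := (Fintype.equivOfCardEq (Fintype.card_fin _)).symm.trans
    (finCongr (Fintype.card_fin m))
  refine Fintype.sum_equiv e _ _ fun i => ?_
  simp [IsHermitian.eigenvalues, eigDesc, e]

/-! ### Eigenvalue perturbation in operator norm and in trace norm. -/

/-- **Weyl's monotonicity principle** with a shift. -/
lemma eigDesc_le_add {H K : Matrix (Fin m) (Fin m) ℂ} (hH : H.IsHermitian) (hK : K.IsHermitian)
    {b : ℝ} (h : ∀ x, quad H x ≤ quad K x + b * quad 1 x) (i : Fin m) :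
    eigDesc hH i ≤ eigDesc hK i + b := by
  obtain ⟨v, hv⟩ := exists_eigenbasis hH
  obtain ⟨w, hw⟩ := exists_eigenbasis hK
  -- These `m - 1` functionals have a common nonzero zero `u`, which lies in the span of the `v l`
  -- with `l ≤ i` and in that of the `w l` with `l ≥ i`.
  let L : EuclideanSpace ℂ (Fin m) →ₗ[ℂ] ({l : Fin m // l ≠ i} → ℂ) :=
    LinearMap.pi fun l => if l.1 < i then (innerSL ℂ (w l)).toLinearMap
      else (innerSL ℂ (v l)).toLinearMap
  have hlt : Module.finrank ℂ ({l : Fin m // l ≠ i} → ℂ) <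
      Module.finrank ℂ (EuclideanSpace ℂ (Fin m)) := by
    simp only [Module.finrank_fintype_fun_eq_card, finrank_euclideanSpace]
    exact Fintype.card_subtype_lt (x := i) (by simp)
  obtain ⟨u, hu, hu0⟩ := (Submodule.ne_bot_iff _).1 (LinearMap.ker_ne_bot_of_finrank_lt (f := L) hlt)
  have hL : ∀ l : {l : Fin m // l ≠ i}, L u l = 0 := fun l => by
    rw [LinearMap.mem_ker.1 hu]; rfl
  have hwu : ∀ l, l < i → inner ℂ (w l) u = 0 := fun l hl => by
    simpa [L, hl] using hL ⟨l, hl.ne⟩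
  have hvu : ∀ l, i < l → inner ℂ (v l) u = 0 := fun l hl => by
    simpa [L, hl.not_gt] using hL ⟨l, hl.ne'⟩
  have h1 : eigDesc hH i * ‖u‖ ^ 2 ≤ quad H u.ofLp := by
    rw [quad_eq_sum hv, ← v.sum_sq_norm_inner_right u, Finset.mul_sum]
    refine Finset.sum_le_sum fun l _ => ?_
    rcases le_or_gt l i with hl | hl
    · exact mul_le_mul_of_nonneg_right (eigDesc_antitone hH hl) (by positivity)
    · simp [hvu l hl]
  have h2 : quad K u.ofLp ≤ eigDesc hK i * ‖u‖ ^ 2 := by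
    rw [quad_eq_sum hw, ← w.sum_sq_norm_inner_right u, Finset.mul_sum]
    refine Finset.sum_le_sum fun l _ => ?_
    rcases le_or_gt i l with hl | hl
    · exact mul_le_mul_of_nonneg_right (eigDesc_antitone hK hl) (by positivity)
    · simp [hwu l hl]
  have h3 := h u.ofLp
  rw [quad_one, ← EuclideanSpace.norm_sq_eq] at h3
  have h4 : 0 < ‖u‖ ^ 2 := by positivity
  exact le_of_mul_le_mul_right (by linarith) h4

lemma abs_eigDesc_sub_le {H K : Matrix (Fin m) (Fin m) ℂ} (hH : H.IsHermitian)
    (hK : K.IsHermitian) {b : ℝ} (h : ∀ x, |quad (K - H) x| ≤ b * quad 1 x) (i : Fin m) :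
    |eigDesc hK i - eigDesc hH i| ≤ b := by
  have h' := fun x => abs_le.1 (h x)
  simp only [quad_sub] at h'
  have h1 := eigDesc_le_add hH hK (b := b) (fun x => by linarith [(h' x).1]) i
  have h2 := eigDesc_le_add hK hH (b := b) (fun x => by linarith [(h' x).2]) i
  exact abs_le.2 ⟨by linarith, by linarith⟩

lemma eigDesc_mono {H K : Matrix (Fin m) (Fin m) ℂ} (hH : H.IsHermitian) (hK : K.IsHermitian)
    (h : ∀ x, quad H x ≤ quad K x) (i : Fin m) : eigDesc hH i ≤ eigDesc hK i := by
  simpa using eigDesc_le_add hH hK (b := 0) (by simpa using h) i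

/-- The `ℓ¹` distance of the spectra is at most the trace of any majorant of the difference. -/
lemma sum_abs_eigDesc_sub_le {H K T : Matrix (Fin m) (Fin m) ℂ} (hH : H.IsHermitian)
    (hK : K.IsHermitian) (hT : T.IsHermitian) (h : ∀ x, |quad (K - H) x| ≤ quad T x) :
    ∑ i, |eigDesc hK i - eigDesc hH i| ≤ T.trace.re := by
  have h' := fun x => abs_le.1 (h x)
  simp only [quad_sub] at h'
  -- `P` dominates both `H` and `K`, so each gap is at most the sum of the two nonnegative gaps to
  -- `P`; these total `2 tr P - tr H - tr K = tr T`.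
  let P := ((1 / 2 : ℝ) : ℂ) • (H + K + T)
  have hP : P.IsHermitian := ((hH.add hK).add hT).smul (by
    rw [isSelfAdjoint_iff, Complex.star_def, Complex.conj_ofReal])
  have hq : ∀ x, quad P x = 1 / 2 * (quad H x + quad K x + quad T x) := fun x => by
    simp only [P, quad_real_smul, quad_add]
  have h1 := eigDesc_mono hH hP fun x => by rw [hq]; linarith [(h' x).1]
  have h2 := eigDesc_mono hK hP fun x => by rw [hq]; linarith [(h' x).2]
  have hsum : ∑ i, |eigDesc hK i - eigDesc hH i| ≤
      ∑ i, ((eigDesc hP i - eigDesc hH i) + (eigDesc hP i - eigDesc hK i)) :=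
    Finset.sum_le_sum fun i _ => abs_le.2 ⟨by linarith [h1 i, h2 i], by linarith [h1 i, h2 i]⟩
  refine hsum.trans (le_of_eq ?_)
  simp only [Finset.sum_add_distrib, Finset.sum_sub_distrib, sum_eigDesc, P, trace_smul,
    trace_add, smul_eq_mul, Complex.re_ofReal_mul, Complex.add_re]
  ring

/-- Perturbation bound for a difference split into a part bounded in operator norm and a part
bounded in trace norm. -/
lemma sum_abs_eigDesc_sub_le_of_split {H K D T : Matrix (Fin m) (Fin m) ℂ} (hH : H.IsHermitian)
    (hK : K.IsHermitian) (hD : D.IsHermitian) (hT : T.IsHermitian) {b : ℝ}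
    (hb : ∀ x, |quad D x| ≤ b * quad 1 x) (h : ∀ x, |quad (K - H - D) x| ≤ quad T x)
    (J : Finset (Fin m)) :
    ∑ i ∈ J, |eigDesc hK i - eigDesc hH i| ≤ J.card * b + T.trace.re := by
  have hHD := hH.add hD
  have h1 : ∀ i, |eigDesc hHD i - eigDesc hH i| ≤ b :=
    abs_eigDesc_sub_le hH hHD (by simpa using hb)
  have h2 := sum_abs_eigDesc_sub_le hHD hK hT (by simpa [sub_sub] using h)
  calc ∑ i ∈ J, |eigDesc hK i - eigDesc hH i|
      ≤ ∑ i ∈ J, (b + |eigDesc hK i - eigDesc hHD i|) := Finset.sum_le_sum fun i _ => by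
        linarith [abs_sub_le (eigDesc hK i) (eigDesc hHD i) (eigDesc hH i), h1 i]
    _ = J.card * b + ∑ i ∈ J, |eigDesc hK i - eigDesc hHD i| := by
        simp [Finset.sum_add_distrib]
    _ ≤ J.card * b + T.trace.re := by
        gcongr
        exact (Finset.sum_le_sum_of_subset_of_nonneg (Finset.subset_univ J)
          fun _ _ _ => abs_nonneg _).trans h2

/-! ### Operator norms and Schur multipliers. -/

lemma sum_norm_mulVec_sq_le {n k : ℕ} (M : Matrix (Fin n) (Fin k) ℂ) (x : Fin k → ℂ) :
    ∑ i, ‖(M *ᵥ x) i‖ ^ 2 ≤ ‖M‖ ^ 2 * ∑ i, ‖x i‖ ^ 2 := by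
  have h := l2_opNorm_mulVec M (WithLp.toLp 2 x)
  have h2 := pow_le_pow_left₀ (norm_nonneg _) h 2
  rw [mul_pow, EuclideanSpace.norm_sq_eq, EuclideanSpace.norm_sq_eq] at h2
  simpa using h2

lemma abs_quad_le (M : Matrix (Fin m) (Fin m) ℂ) (x : Fin m → ℂ) :
    |quad M x| ≤ ‖M‖ * quad 1 x := by
  have h := l2_opNorm_mulVec M (WithLp.toLp 2 x)
  have h1 : quad M x = (inner ℂ (WithLp.toLp 2 x) (WithLp.toLp 2 (M *ᵥ x))).re := by
    rw [EuclideanSpace.inner_eq_star_dotProduct, quad, dotProduct_comm]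
  have h2 : quad 1 x = ‖WithLp.toLp 2 x‖ ^ 2 := by
    rw [quad_one, EuclideanSpace.norm_sq_eq]
  rw [h1, h2]
  refine (Complex.abs_re_le_norm _).trans ((norm_inner_le_norm _ _).trans ?_)
  calc _ ≤ ‖WithLp.toLp 2 x‖ * (‖M‖ * ‖WithLp.toLp 2 x‖) :=
        mul_le_mul_of_nonneg_left h (norm_nonneg _)
    _ = _ := by ring

lemma sum_norm_row_sq_le {B : Matrix (Fin m) (Fin m) ℂ} (hB : B.IsHermitian) (i : Fin m) :
    ∑ j, ‖B i j‖ ^ 2 ≤ ‖B‖ ^ 2 := by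
  have h := sum_norm_mulVec_sq_le B (Pi.single i 1)
  have h1 : ∑ j, ‖(Pi.single i 1 : Fin m → ℂ) j‖ ^ 2 = 1 := by
    rw [Finset.sum_eq_single i] <;> simp +contextual
  rw [h1, mul_one, mulVec_single_one] at h
  refine le_trans (le_of_eq (Finset.sum_congr rfl fun j _ => ?_)) h
  rw [col_apply, ← hB.apply j i, norm_star]

lemma quad_diagonal (u : Fin m → ℝ) (x : Fin m → ℂ) :
    quad (diagonal fun i => (u i : ℂ)) x = ∑ i, u i * ‖x i‖ ^ 2 := by
  simp only [quad, mulVec_diagonal, dotProduct, Complex.re_sum]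
  refine Finset.sum_congr rfl fun i _ => ?_
  rw [Pi.star_apply, Complex.star_def, mul_left_comm, ← Complex.normSq_eq_conj_mul_self,
    ← Complex.ofReal_mul, Complex.ofReal_re, Complex.normSq_eq_norm_sq]

lemma quad_conjTranspose_mul_mul (M K : Matrix (Fin m) (Fin m) ℂ) (x : Fin m → ℂ) :
    quad (Kᴴ * M * K) x = quad M (K *ᵥ x) := by
  rw [quad, quad, star_mulVec, ← dotProduct_mulVec, mulVec_mulVec, mulVec_mulVec, mul_assoc]

lemma isHermitian_diagonal_ofReal (u : Fin m → ℝ) :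
    (diagonal fun i => (u i : ℂ)).IsHermitian := by
  rw [isHermitian_diagonal_iff]
  intro i
  rw [isSelfAdjoint_iff, Complex.star_def, Complex.conj_ofReal]

/-- A Schur multiplier dominated by `u i + u j` maps a Hermitian matrix of norm at most `h` to one
of trace norm at most `2 h ∑ u`. -/
lemma exists_majorant_of_multiplier {B : Matrix (Fin m) (Fin m) ℂ} (hB : B.IsHermitian) {h : ℝ}
    (hBh : ‖B‖ ≤ h) {w : Fin m → Fin m → ℝ} {u : Fin m → ℝ} (hu : ∀ i, 0 ≤ u i)
    (hs : ∀ i j, w i j = w j i) (hw : ∀ i j, |w i j| ≤ u i + u j) :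
    ∃ T : Matrix (Fin m) (Fin m) ℂ, T.IsHermitian ∧
      (∀ x, |quad (of fun i j => (w i j : ℂ) * B i j) x| ≤ quad T x) ∧
      T.trace.re ≤ 2 * h * ∑ i, u i := by
  have h0 : 0 ≤ h := (norm_nonneg _).trans hBh
  -- Dividing by `u i + u j` splits the multiple as `D K + Kᴴ D`. Entrywise shrinking need not
  -- preserve the operator norm, but it keeps row norms at most `h`, which is all the trace needs.
  -- Where `u i + u j = 0`, also `w i j = 0`.
  let K : Matrix (Fin m) (Fin m) ℂ := of fun i j => ((w i j / (u i + u j) : ℝ) : ℂ) * B i j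
  let D : Matrix (Fin m) (Fin m) ℂ := diagonal fun i => (u i : ℂ)
  have hD : D.IsHermitian := isHermitian_diagonal_ofReal u
  have hKB : ∀ i j, ‖K i j‖ ≤ ‖B i j‖ := fun i j => by
    simp only [K, of_apply, norm_mul, Complex.norm_real, Real.norm_eq_abs, abs_div]
    refine mul_le_of_le_one_left (norm_nonneg _) ?_
    rw [abs_of_nonneg (add_nonneg (hu i) (hu j))]
    exact div_le_one_of_le₀ (hw i j) (add_nonneg (hu i) (hu j))
  have hKrow : ∀ i, ∑ j, ‖K i j‖ ^ 2 ≤ h ^ 2 := fun i =>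
    (Finset.sum_le_sum fun j _ => pow_le_pow_left₀ (norm_nonneg _) (hKB i j) 2).trans
      ((sum_norm_row_sq_le hB i).trans (pow_le_pow_left₀ (norm_nonneg _) hBh 2))
  have hM : (of fun i j => (w i j : ℂ) * B i j) = D * K + Kᴴ * D := by
    ext i j
    have hz : w i j = (u i + u j) * (w i j / (u i + u j)) := by
      rcases eq_or_ne (u i + u j) 0 with h | h
      · have := hw i j
        rw [h] at this
        rw [h, abs_nonpos_iff.1 this]; simp
      · field_simp
    simp only [D, K, of_apply, Matrix.add_apply, diagonal_mul, mul_diagonal, conjTranspose_apply,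
      star_mul', Complex.star_def, Complex.conj_ofReal]
    rw [← Complex.star_def, hB.apply, hs j i, add_comm (u j)]
    conv_lhs => rw [hz]
    push_cast
    ring
  have hsm : ∀ r : ℝ, IsSelfAdjoint (r : ℂ) := fun r => by
    rw [isSelfAdjoint_iff, Complex.star_def, Complex.conj_ofReal]
  -- The majorant comes from `2 |x i| |(K x) i| ≤ h |x i|² + h⁻¹ |(K x) i|²`, weighted by `u i`;
  -- each summand has trace at most `h ∑ u`. For `h = 0` the inverse is `0`, harmless because `K`
  -- vanishes.
  refine ⟨(h : ℂ) • D + ((h⁻¹ : ℝ) : ℂ) • (Kᴴ * D * K), ?_, fun x => ?_, ?_⟩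
  · exact (hD.smul (hsm _)).add ((isHermitian_conjTranspose_mul_mul K hD).smul (hsm _))
  · have hq : quad (D * K + Kᴴ * D) x =
        ∑ i, u i * (2 * (star (x i) * (K *ᵥ x) i).re) := by
      have h1 : quad (D * K) x = ∑ i, u i * (star (x i) * (K *ᵥ x) i).re := by
        simp only [quad, ← mulVec_mulVec, D, mulVec_diagonal, dotProduct, Complex.re_sum]
        refine Finset.sum_congr rfl fun i _ => ?_
        rw [Pi.star_apply, mul_left_comm, Complex.re_ofReal_mul]
      have h2 : quad (Kᴴ * D) x = quad (D * K) x := by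
        have : star x ⬝ᵥ ((Kᴴ * D) *ᵥ x) = star (star x ⬝ᵥ ((D * K) *ᵥ x)) := by
          rw [star_dotProduct, star_mulVec, conjTranspose_mul, conjTranspose_conjTranspose,
            hD.eq, ← dotProduct_mulVec]
        rw [quad, this, quad, Complex.star_def, Complex.conj_re]
      rw [quad_add, h2, h1, ← Finset.sum_add_distrib]
      exact Finset.sum_congr rfl fun i _ => by ring
    rw [hM, hq, quad_add, quad_real_smul, quad_real_smul, quad_conjTranspose_mul_mul,
      quad_diagonal, quad_diagonal, Finset.mul_sum, Finset.mul_sum, ← Finset.sum_add_distrib]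
    refine (Finset.abs_sum_le_sum_abs _ _).trans (Finset.sum_le_sum fun i _ => ?_)
    rw [abs_mul, abs_of_nonneg (hu i), abs_mul, abs_two]
    have h1 : |(star (x i) * (K *ᵥ x) i).re| ≤ ‖x i‖ * ‖(K *ᵥ x) i‖ := by
      refine (Complex.abs_re_le_norm _).trans ?_
      rw [norm_mul, norm_star]
    have h2 : 2 * (‖x i‖ * ‖(K *ᵥ x) i‖) ≤ h * ‖x i‖ ^ 2 + h⁻¹ * ‖(K *ᵥ x) i‖ ^ 2 := by
      rcases h0.eq_or_lt with hz | hp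
      · have hK0 : ∀ j, K i j = 0 := fun j => by
          have h3 := (Finset.single_le_sum (f := fun j => ‖K i j‖ ^ 2)
            (fun _ _ => by positivity) (Finset.mem_univ j)).trans (hKrow i)
          rw [← hz] at h3
          have h4 : ‖K i j‖ ^ 2 = 0 := le_antisymm (by simpa using h3) (by positivity)
          simpa using h4
        have : (K *ᵥ x) i = 0 := by simp [mulVec, dotProduct, hK0]
        simp [this, ← hz]
      · have : h * ‖x i‖ ^ 2 + h⁻¹ * ‖(K *ᵥ x) i‖ ^ 2 - 2 * (‖x i‖ * ‖(K *ᵥ x) i‖) =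
            h⁻¹ * (h * ‖x i‖ - ‖(K *ᵥ x) i‖) ^ 2 := by
          field_simp
          ring
        nlinarith [mul_nonneg (inv_nonneg.2 h0) (sq_nonneg (h * ‖x i‖ - ‖(K *ᵥ x) i‖))]
    nlinarith [mul_le_mul_of_nonneg_left h1 (hu i), mul_le_mul_of_nonneg_left h2 (hu i)]
  · have h1 : (Kᴴ * D * K).trace = ∑ i, (u i : ℂ) * ∑ j, ((‖K i j‖ ^ 2 : ℝ) : ℂ) := by
      rw [mul_assoc, trace_mul_comm, trace]
      refine Finset.sum_congr rfl fun i _ => ?_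
      rw [diag_apply, mul_apply, Finset.mul_sum]
      refine Finset.sum_congr rfl fun j _ => ?_
      rw [diagonal_mul, conjTranspose_apply, mul_assoc, Complex.star_def, Complex.mul_conj,
        Complex.normSq_eq_norm_sq]
    have h2 : (Kᴴ * D * K).trace.re ≤ (∑ i, u i) * h ^ 2 := by
      rw [h1, Complex.re_sum, Finset.sum_mul]
      refine Finset.sum_le_sum fun i _ => ?_
      rw [← Complex.ofReal_sum, ← Complex.ofReal_mul, Complex.ofReal_re]
      exact mul_le_mul_of_nonneg_left (hKrow i) (hu i)
    have h3 : D.trace.re = ∑ i, u i := by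
      simp [D, trace_diagonal]
    rw [trace_add, trace_smul, trace_smul, Complex.add_re, smul_eq_mul, smul_eq_mul,
      Complex.re_ofReal_mul, Complex.re_ofReal_mul, h3]
    have h4 : h⁻¹ * (Kᴴ * D * K).trace.re ≤ h⁻¹ * ((∑ i, u i) * h ^ 2) :=
      mul_le_mul_of_nonneg_left h2 (inv_nonneg.2 h0)
    have h5 : h⁻¹ * ((∑ i, u i) * h ^ 2) = h * ∑ i, u i := by
      rcases eq_or_ne h 0 with hz | hz
      · simp [hz]
      · field_simp
    linarith

lemma norm_diagonal_ofReal_le {u : Fin m → ℝ} {r : ℝ} (hr : 0 ≤ r) (hu : ∀ i, |u i| ≤ r) :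
    ‖(diagonal fun i => (u i : ℂ) : Matrix (Fin m) (Fin m) ℂ)‖ ≤ r := by
  rw [l2_opNorm_diagonal, pi_norm_le_iff_of_nonneg hr]
  intro i
  rw [Complex.norm_real]
  exact hu i

lemma norm_diagonal_mul_mul_diagonal_le {u v : Fin m → ℝ} {r s h : ℝ} (hr : 0 ≤ r) (hs : 0 ≤ s)
    (hu : ∀ i, |u i| ≤ r) (hv : ∀ i, |v i| ≤ s) {B : Matrix (Fin m) (Fin m) ℂ} (hB : ‖B‖ ≤ h) :
    ‖(of fun i j => (u i : ℂ) * B i j * (v j : ℂ) : Matrix (Fin m) (Fin m) ℂ)‖ ≤ r * h * s := by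
  have h0 : 0 ≤ h := (norm_nonneg _).trans hB
  have : (of fun i j => (u i : ℂ) * B i j * (v j : ℂ) : Matrix (Fin m) (Fin m) ℂ) =
      diagonal (fun i => (u i : ℂ)) * B * diagonal fun i => (v i : ℂ) := by
    ext i j
    simp [diagonal_mul, mul_diagonal]
  rw [this]
  refine (l2_opNorm_mul _ _).trans ?_
  refine mul_le_mul ((l2_opNorm_mul _ _).trans ?_) (norm_diagonal_ofReal_le hs hv)
    (norm_nonneg _) (mul_nonneg hr h0)
  exact mul_le_mul (norm_diagonal_ofReal_le hr hu) hB (norm_nonneg _) hr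

lemma isHermitian_of_multiplier {B : Matrix (Fin m) (Fin m) ℂ} (hB : B.IsHermitian)
    {w : Fin m → Fin m → ℝ} (hs : ∀ i j, w i j = w j i) :
    (of fun i j => (w i j : ℂ) * B i j : Matrix (Fin m) (Fin m) ℂ).IsHermitian := by
  ext i j
  rw [conjTranspose_apply, of_apply, of_apply, star_mul', hB.apply, hs j i, Complex.star_def,
    Complex.conj_ofReal]

/-- The identity `1 - c i * c j = ((1 - c i)(1 + c j) + (1 + c i)(1 - c j)) / 2` reduces the
multiplier to two-sided diagonal scalings. -/
lemma norm_multiplier_sub_one_le {B : Matrix (Fin m) (Fin m) ℂ} {h γ : ℝ} (hB : ‖B‖ ≤ h)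
    {c : Fin m → ℝ} (h0 : 0 ≤ γ) (hγ : ∀ i, γ ≤ c i) (h1 : ∀ i, c i ≤ 1) (hγ1 : γ ≤ 1) :
    ‖(of fun i j => ((c i * c j - 1 : ℝ) : ℂ) * B i j : Matrix (Fin m) (Fin m) ℂ)‖ ≤
      h * (2 * (1 - γ)) := by
  have hE : ∀ i, |1 - c i| ≤ 1 - γ := fun i => by
    rw [abs_of_nonneg (by linarith [h1 i])]; linarith [hγ i]
  have hG : ∀ i, |1 + c i| ≤ 2 := fun i => by
    rw [abs_of_nonneg (by linarith [hγ i])]; linarith [h1 i]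
  have e1 := norm_diagonal_mul_mul_diagonal_le (by linarith) zero_le_two hE hG hB
  have e2 := norm_diagonal_mul_mul_diagonal_le zero_le_two (by linarith) hG hE hB
  have key : (of fun i j => ((c i * c j - 1 : ℝ) : ℂ) * B i j : Matrix (Fin m) (Fin m) ℂ) =
      (-1 / 2 : ℂ) •
        ((of fun i j => ((1 - c i : ℝ) : ℂ) * B i j * ((1 + c j : ℝ) : ℂ)) +
          of fun i j => ((1 + c i : ℝ) : ℂ) * B i j * ((1 - c j : ℝ) : ℂ)) := by
    ext i j
    simp only [of_apply, Matrix.smul_apply, Matrix.add_apply, smul_eq_mul]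
    push_cast
    ring
  rw [key, norm_smul]
  have e3 := norm_add_le
    (of fun i j => ((1 - c i : ℝ) : ℂ) * B i j * ((1 + c j : ℝ) : ℂ) : Matrix (Fin m) (Fin m) ℂ)
    (of fun i j => ((1 + c i : ℝ) : ℂ) * B i j * ((1 - c j : ℝ) : ℂ))
  have e4 : ‖(-1 / 2 : ℂ)‖ = 1 / 2 := by norm_num
  rw [e4]
  linarith

/-! ### Truncation at the index `j`. -/

lemma sum_threshold {f : Fin m → ℝ} (j : Fin m) :
    (∑ i ∈ Finset.Iic j, f i) = (j + 1 : ℝ) * f j + ∑ i ∈ Finset.Iic j, (f i - f j) := by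
  simp [Finset.sum_sub_distrib]

/-- The eigenvalue estimate in diagonal coordinates: `c` holds the cosines of the principal
angles in ascending order and `q` their sines. -/
theorem sum_abs_eigDesc_sub_le_of_multiplier {H K a b : Matrix (Fin m) (Fin m) ℂ}
    (hH : H.IsHermitian) (hK : K.IsHermitian) (ha : a.IsHermitian) (hb : b.IsHermitian) {h : ℝ}
    (hah : ‖a‖ ≤ h) (hbh : ‖b‖ ≤ h) {c q : Fin m → ℝ} (hc : Monotone c) (hq : Antitone q)
    (hc0 : ∀ i, 0 ≤ c i) (hc1 : ∀ i, c i ≤ 1) (hq0 : ∀ i, 0 ≤ q i)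
    (hKH : ∀ i j, K i j - H i j =
      ((c i * c j - 1 : ℝ) : ℂ) * a i j + ((q i * q j : ℝ) : ℂ) * b i j)
    (j : Fin m) (J : Finset (Fin m)) (hJ : J.card = j + 1) :
    ∑ i ∈ J, |eigDesc hK i - eigDesc hH i| ≤
      ∑ i ∈ Finset.Iic j, h * (2 * (1 - c i) + q i ^ 2) := by
  -- Truncation changes nothing at indices beyond `j`, so `u` and `v` are supported on `Iic j`. They
  -- dominate the changes of `c i * c l` (since `c' ≤ 1`) and of `q i * q l` (by the
  -- arithmetic-geometric mean inequality).
  let c' : Fin m → ℝ := fun i => max (c i) (c j)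
  let q' : Fin m → ℝ := fun i => min (q i) (q j)
  let u : Fin m → ℝ := fun i => c' i - c i
  let v : Fin m → ℝ := fun i => (q i ^ 2 - q' i ^ 2) / 2
  have hcc : ∀ i, c i ≤ c' i := fun i => le_max_left _ _
  have hcj : ∀ i, c j ≤ c' i := fun i => le_max_right _ _
  have hc'1 : ∀ i, c' i ≤ 1 := fun i => max_le (hc1 i) (hc1 j)
  have hq'0 : ∀ i, 0 ≤ q' i := fun i => le_min (hq0 i) (hq0 j)
  have hqq : ∀ i, q' i ≤ q i := fun i => min_le_left _ _
  have hqj : ∀ i, q' i ≤ q j := fun i => min_le_right _ _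
  let D1 : Matrix (Fin m) (Fin m) ℂ := of fun i j => ((c' i * c' j - 1 : ℝ) : ℂ) * a i j
  let D2 : Matrix (Fin m) (Fin m) ℂ := of fun i j => ((q' i * q' j : ℝ) : ℂ) * b i j
  have hD1 : D1.IsHermitian := isHermitian_of_multiplier ha fun i j => by ring
  have hD2 : D2.IsHermitian := isHermitian_of_multiplier hb fun i j => by ring
  have nD1 : ‖D1‖ ≤ h * (2 * (1 - c j)) :=
    norm_multiplier_sub_one_le hah (hc0 j) hcj hc'1 (hc1 j)
  have nD2 : ‖D2‖ ≤ q j * h * q j := by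
    have hq'j : ∀ i, |q' i| ≤ q j := fun i => by rw [abs_of_nonneg (hq'0 i)]; exact hqj i
    refine le_trans (le_of_eq (congrArg norm ?_))
      (norm_diagonal_mul_mul_diagonal_le (hq0 j) (hq0 j) hq'j hq'j hbh)
    ext i l
    simp only [D2, of_apply]
    push_cast
    ring
  obtain ⟨T1, hT1, hT1q, hT1t⟩ := exists_majorant_of_multiplier ha hah
    (w := fun i j => c i * c j - c' i * c' j) (u := u) (fun i => sub_nonneg.2 (hcc i))
    (fun i j => by ring) (fun i l => by
      rw [abs_sub_comm, abs_of_nonneg (sub_nonneg.2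
        (mul_le_mul (hcc i) (hcc l) (hc0 l) ((hc0 i).trans (hcc i))))]
      simp only [u]
      nlinarith [hcc i, hcc l, hc'1 i, hc'1 l, hc0 i, hc0 l, hc1 i, hc1 l,
        mul_nonneg (sub_nonneg.2 (hcc i)) (sub_nonneg.2 (hc'1 l)),
        mul_nonneg (sub_nonneg.2 (hcc l)) (sub_nonneg.2 (hc1 i))])
  obtain ⟨T2, hT2, hT2q, hT2t⟩ := exists_majorant_of_multiplier hb hbh
    (w := fun i j => q i * q j - q' i * q' j) (u := v)
    (fun i => by simp only [v]; nlinarith [hqq i, hq'0 i])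
    (fun i j => by ring) (fun i l => by
      rw [abs_of_nonneg (sub_nonneg.2 (mul_le_mul (hqq i) (hqq l) (hq'0 l) (hq0 i)))]
      simp only [v, q']
      rcases le_total (q i) (q j) with h1 | h1 <;> rcases le_total (q l) (q j) with h2 | h2 <;>
        simp only [min_eq_left, min_eq_right, h1, h2]
      · simp
      · nlinarith [hq0 i, hq0 l, hq0 j]
      · nlinarith [hq0 i, hq0 l, hq0 j]
      · nlinarith [sq_nonneg (q i - q l)])
  have hq1 : ∀ x, |quad (D1 + D2) x| ≤ (h * (2 * (1 - c j)) + q j * h * q j) * quad 1 x := by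
    intro x
    refine (abs_quad_le _ _).trans (mul_le_mul_of_nonneg_right
      ((norm_add_le _ _).trans (add_le_add nD1 nD2)) ?_)
    rw [quad_one]
    positivity
  have hsplit : K - H - (D1 + D2) = (of fun i l => ((c i * c l - c' i * c' l : ℝ) : ℂ) * a i l) +
      of fun i l => ((q i * q l - q' i * q' l : ℝ) : ℂ) * b i l := by
    ext i l
    simp only [Matrix.sub_apply, hKH, Matrix.add_apply, D1, D2, of_apply]
    push_cast
    ring
  have main := sum_abs_eigDesc_sub_le_of_split hH hK (hD1.add hD2) (hT1.add hT2) hq1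
    (fun x => by
      rw [hsplit, quad_add, quad_add]
      exact (abs_add_le _ _).trans (add_le_add (hT1q x) (hT2q x))) J
  have su : ∑ i, u i = ∑ i ∈ Finset.Iic j, (c j - c i) := by
    rw [← Finset.sum_subset (Finset.subset_univ (Finset.Iic j))]
    · exact Finset.sum_congr rfl fun i hi => by
        simp [u, c', max_eq_right (hc (Finset.mem_Iic.1 hi))]
    · intro i _ hi
      simp [u, c', max_eq_left (hc (le_of_not_ge (by simpa using hi)))]
  have sv : ∑ i, v i = ∑ i ∈ Finset.Iic j, (q i ^ 2 - q j ^ 2) / 2 := by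
    rw [← Finset.sum_subset (Finset.subset_univ (Finset.Iic j))]
    · exact Finset.sum_congr rfl fun i hi => by
        simp [v, q', min_eq_right (hq (Finset.mem_Iic.1 hi))]
    · intro i _ hi
      simp [v, q', min_eq_left (hq (le_of_not_ge (by simpa using hi)))]
  rw [hJ, trace_add, Complex.add_re] at main
  rw [su] at hT1t
  rw [sv] at hT2t
  have fin : ∑ i ∈ Finset.Iic j, h * (2 * (1 - c i) + q i ^ 2) =
      (j + 1 : ℝ) * (h * (2 * (1 - c j)) + q j * h * q j) +
        (2 * h * ∑ i ∈ Finset.Iic j, (c j - c i) +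
          2 * h * ∑ i ∈ Finset.Iic j, (q i ^ 2 - q j ^ 2) / 2) := by
    rw [sum_threshold (f := fun i => h * (2 * (1 - c i) + q i ^ 2)), Finset.mul_sum,
      Finset.mul_sum, ← Finset.sum_add_distrib]
    congr 1
    · ring
    · exact Finset.sum_congr rfl fun i _ => by ring
  rw [fin]
  push_cast at main
  linarith

/-! ### Centring the spectrum. -/

lemma norm_sub_smul_one_le {A : Matrix (Fin m) (Fin m) ℂ} (hA : A.IsHermitian) {μ h : ℝ}
    (h0 : 0 ≤ h) (hμ : ∀ i, |eigDesc hA i - μ| ≤ h) : ‖A - (μ : ℂ) • 1‖ ≤ h := by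
  obtain ⟨v, hv⟩ := exists_eigenbasis hA
  set B := A - (μ : ℂ) • (1 : Matrix (Fin m) (Fin m) ℂ) with hB
  have hBh : Bᴴ = B := by
    simp [hB, conjTranspose_sub, hA.eq, conjTranspose_smul]
  have hBv : ∀ i, B *ᵥ (v i).ofLp = ((eigDesc hA i - μ : ℝ) : ℂ) • (v i).ofLp := fun i => by
    rw [hB, sub_mulVec, hv, smul_mulVec, one_mulVec, ← sub_smul, Complex.ofReal_sub]
  have hBBv : ∀ i, (Bᴴ * 1 * B) *ᵥ (v i).ofLp =
      (((eigDesc hA i - μ) ^ 2 : ℝ) : ℂ) • (v i).ofLp := fun i => by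
    rw [mul_one, hBh, ← mulVec_mulVec, hBv, mulVec_smul, hBv, smul_smul, ← Complex.ofReal_mul,
      sq]
  rw [l2_opNorm_def]
  refine ContinuousLinearMap.opNorm_le_bound _ h0 fun u => ?_
  refine le_of_sq_le_sq ?_ (by positivity)
  have h1 : ‖(toEuclideanLin.trans LinearMap.toContinuousLinearMap) B u‖ ^ 2 =
      quad (Bᴴ * 1 * B) u.ofLp := by
    rw [quad_conjTranspose_mul_mul, quad_one, EuclideanSpace.norm_sq_eq]
    rfl
  rw [h1, quad_eq_sum hBBv, mul_pow, ← v.sum_sq_norm_inner_right u, Finset.mul_sum]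
  refine Finset.sum_le_sum fun i _ => mul_le_mul_of_nonneg_right ?_ (by positivity)
  exact sq_le_sq' (by linarith [(abs_le.1 (hμ i)).1]) (abs_le.1 (hμ i)).2

lemma spread_nonneg {A : Matrix (Fin n) (Fin n) ℂ} (hA : A.IsHermitian) : 0 ≤ spread hA := by
  unfold spread
  split_ifs with h
  · exact sub_nonneg.2 (eigDesc_antitone hA (Fin.mk_le_mk.2 (Nat.zero_le _)))
  · exact le_rfl

lemma exists_norm_sub_smul_one_le {A : Matrix (Fin n) (Fin n) ℂ} (hA : A.IsHermitian) :
    ∃ μ : ℝ, ‖A - (μ : ℂ) • 1‖ ≤ spread hA / 2 := by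
  rcases Nat.eq_zero_or_pos n with rfl | hn
  · refine ⟨0, ?_⟩
    rw [Subsingleton.elim (A - _) 0, norm_zero]
    exact div_nonneg (spread_nonneg hA) zero_le_two
  · refine ⟨(eigDesc hA ⟨0, hn⟩ + eigDesc hA ⟨n - 1, Nat.sub_lt hn Nat.one_pos⟩) / 2,
      norm_sub_smul_one_le hA (div_nonneg (spread_nonneg hA) zero_le_two) fun i => ?_⟩
    have h1 : eigDesc hA i ≤ eigDesc hA ⟨0, hn⟩ :=
      eigDesc_antitone hA (Fin.mk_le_of_le_val (Nat.zero_le _))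
    have h2 : eigDesc hA ⟨n - 1, Nat.sub_lt hn Nat.one_pos⟩ ≤ eigDesc hA i :=
      eigDesc_antitone hA (Fin.le_def.2 (Nat.le_sub_one_of_lt i.2))
    rw [spread, dif_pos hn]
    exact abs_le.2 ⟨by linarith, by linarith⟩

/-! ### Unitary invariance and singular values. -/

lemma eigDesc_eq_of_charpoly_eq {A B : Matrix (Fin m) (Fin m) ℂ} (hA : A.IsHermitian)
    (hB : B.IsHermitian) (h : A.charpoly = B.charpoly) : eigDesc hA = eigDesc hB := by
  have : hA.eigenvalues₀ = hB.eigenvalues₀ := by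
    rw [← List.ofFn_inj, ← IsHermitian.sort_roots_charpoly_eq_eigenvalues₀,
      ← IsHermitian.sort_roots_charpoly_eq_eigenvalues₀, h]
  unfold eigDesc
  rw [this]

lemma eigDesc_conj_mul_right {A : Matrix (Fin n) (Fin n) ℂ} (hA : A.IsHermitian)
    (X : Matrix (Fin n) (Fin k) ℂ) {U : Matrix (Fin k) (Fin k) ℂ} (hU : Uᴴ * U = 1) :
    eigDesc (isHermitian_conjTranspose_mul_mul (X * U) hA) =
      eigDesc (isHermitian_conjTranspose_mul_mul X hA) := by
  refine eigDesc_eq_of_charpoly_eq _ _ ?_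
  have h : (X * U)ᴴ * A * (X * U) = Uᴴ * (Xᴴ * A * X * U) := by
    simp only [conjTranspose_mul, Matrix.mul_assoc]
  rw [h, charpoly_mul_comm, Matrix.mul_assoc _ U, mul_eq_one_comm.1 hU, mul_one]

/-- **Singular value decomposition**, with the singular values in ascending order. -/
lemma exists_svd (M : Matrix (Fin k) (Fin k) ℂ) :
    ∃ U V : Matrix (Fin k) (Fin k) ℂ, Uᴴ * U = 1 ∧ Vᴴ * V = 1 ∧
      Uᴴ * M * V = diagonal fun i => (singDesc M (Fin.rev i) : ℂ) := by
  set T := toEuclideanLin M with hT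
  have hfr : Module.finrank ℂ (EuclideanSpace ℂ (Fin k)) = k := by simp
  let v := T.isSymmetric_adjoint_comp_self.eigenvectorBasis hfr
  let σ : Fin k → ℝ := fun i => T.singularValues i
  have hin : ∀ i j, inner ℂ (T (v i)) (T (v j)) = if i = j then ((σ j ^ 2 : ℝ) : ℂ) else 0 := by
    intro i j
    have h1 : (T.adjoint ∘ₗ T) (v j) = ((σ j ^ 2 : ℝ) : ℂ) • v j := by
      rw [T.sq_singularValues_fin hfr j]
      exact T.isSymmetric_adjoint_comp_self.apply_eigenvectorBasis hfr j
    rw [← LinearMap.adjoint_inner_right, ← LinearMap.comp_apply, h1, inner_smul_right,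
      orthonormal_iff_ite.1 v.orthonormal]
    split_ifs <;> simp
  -- Left singular vectors: orthonormal where `σ i ≠ 0`, then completed arbitrarily, since `T (v i)
  -- = 0` at the other indices.
  let f : Fin k → EuclideanSpace ℂ (Fin k) := fun i => ((σ i)⁻¹ : ℂ) • T (v i)
  have hf : Orthonormal ℂ (Set.domRestrict {i | σ i ≠ 0} f) := by
    rw [orthonormal_iff_ite]
    rintro ⟨i, hi⟩ ⟨j, hj⟩
    have hi' : (σ i : ℂ) ≠ 0 := Complex.ofReal_ne_zero.2 hi
    simp only [Set.domRestrict_apply, f, inner_smul_left, inner_smul_right, hin, Subtype.mk.injEq]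
    split_ifs with h
    · subst h
      simp only [map_inv₀, Complex.conj_ofReal]
      push_cast
      field_simp
    · simp
  obtain ⟨b, hb⟩ := hf.exists_orthonormalBasis_extension_of_card_eq (by simp)
  have hTv : ∀ i, T (v i) = (σ i : ℂ) • b i := by
    intro i
    by_cases hi : σ i = 0
    · have := hin i i
      rw [if_pos rfl, hi] at this
      simpa [hi] using this
    · rw [hb i hi]
      simp [f, smul_smul, hi]
  refine ⟨of fun i j => b (Fin.rev j) i, of fun i j => v (Fin.rev j) i, ?_, ?_, ?_⟩
  · ext i j
    have h := orthonormal_iff_ite.1 b.orthonormal (Fin.rev i) (Fin.rev j)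
    rw [EuclideanSpace.inner_eq_star_dotProduct, dotProduct_comm] at h
    rw [one_apply]
    simpa [mul_apply, dotProduct] using h
  · ext i j
    have h := orthonormal_iff_ite.1 v.orthonormal (Fin.rev i) (Fin.rev j)
    rw [EuclideanSpace.inner_eq_star_dotProduct, dotProduct_comm] at h
    rw [one_apply]
    simpa [mul_apply, dotProduct] using h
  · ext i j
    have h : inner ℂ (b (Fin.rev i)) (T (v (Fin.rev j))) =
        if i = j then (σ (Fin.rev j) : ℂ) else 0 := by
      rw [hTv, inner_smul_right, orthonormal_iff_ite.1 b.orthonormal]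
      simp
    rw [EuclideanSpace.inner_eq_star_dotProduct, dotProduct_comm, hT, toLpLin_apply] at h
    rw [Matrix.mul_assoc, mul_apply, diagonal_apply]
    convert! h using 1
    split_ifs with hij
    · rw [hij]; rfl
    · rfl

/-! ### Bases in principal position. -/

lemma norm_le_one_of_conjTranspose_mul_self {X : Matrix (Fin n) (Fin k) ℂ} {d : Fin k → ℝ}
    (hX : Xᴴ * X = diagonal fun i => (d i : ℂ)) (hd : ∀ i, |d i| ≤ 1) : ‖X‖ ≤ 1 := by
  have h := l2_opNorm_conjTranspose_mul_self X
  rw [hX] at h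
  have h2 := norm_diagonal_ofReal_le zero_le_one hd
  nlinarith [norm_nonneg X]

lemma norm_conjTranspose_mul_mul_le {A : Matrix (Fin n) (Fin n) ℂ} {X : Matrix (Fin n) (Fin k) ℂ}
    {h : ℝ} (hA : ‖A‖ ≤ h) (hX : ‖X‖ ≤ 1) : ‖Xᴴ * A * X‖ ≤ h := by
  have h0 : 0 ≤ h := (norm_nonneg _).trans hA
  have h1 : ‖Xᴴ‖ ≤ 1 := (l2_opNorm_conjTranspose X).trans_le hX
  calc ‖Xᴴ * A * X‖ ≤ ‖Xᴴ * A‖ * ‖X‖ := l2_opNorm_mul _ _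
    _ ≤ ‖Xᴴ‖ * ‖A‖ * ‖X‖ := by gcongr; exact l2_opNorm_mul _ _
    _ ≤ 1 * h * 1 := by gcongr
    _ = h := by ring

lemma exists_mul_eq_of_invariant {A : Matrix (Fin n) (Fin n) ℂ} {X : Matrix (Fin n) (Fin k) ℂ}
    {S : Submodule ℂ (Fin n → ℂ)} (hX : LinearMap.range X.mulVecLin = S)
    (hS : IsInvariantUnder A S) : ∃ W : Matrix (Fin k) (Fin k) ℂ, A * X = X * W := by
  have h : ∀ j, ∃ w : Fin k → ℂ, X *ᵥ w = A *ᵥ (X *ᵥ Pi.single j 1) := fun j => by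
    have h1 : X *ᵥ Pi.single j 1 ∈ S := hX ▸ ⟨_, rfl⟩
    have h2 := hS _ h1
    rw [← hX] at h2
    exact h2
  choose w hw using h
  refine ⟨of fun i j => w j i, ?_⟩
  ext i j
  have := congrFun (hw j) i
  rw [mulVec_mulVec, mulVec_single_one, col_apply] at this
  rw [← this]
  rfl

/-- The estimate for an invariant basis `X` in principal position with respect to `Y`. -/
theorem sum_abs_eigDesc_sub_le_of_principal {A : Matrix (Fin n) (Fin n) ℂ} (hA : A.IsHermitian)
    {X Y : Matrix (Fin n) (Fin k) ℂ} (hX : Xᴴ * X = 1) (hY : Yᴴ * Y = 1) {c : Fin k → ℝ}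
    (hc : Monotone c) (hc0 : ∀ i, 0 ≤ c i) (hXY : Xᴴ * Y = diagonal fun i => (c i : ℂ))
    {W : Matrix (Fin k) (Fin k) ℂ} (hW : A * X = X * W) :
    (∀ i, c i ≤ 1) ∧ ∀ (j : Fin k) (J : Finset (Fin k)), J.card = j + 1 →
      ∑ i ∈ J, |eigDesc (isHermitian_conjTranspose_mul_mul Y hA) i -
          eigDesc (isHermitian_conjTranspose_mul_mul X hA) i| ≤
        ∑ i ∈ Finset.Iic j, spread hA / 2 * (2 * (1 - c i) + (1 - c i ^ 2)) := by
  set C : Matrix (Fin k) (Fin k) ℂ := diagonal fun i => (c i : ℂ) with hC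
  have hCC : Cᴴ = C := (isHermitian_diagonal_ofReal c).eq
  have hYX : Yᴴ * X = C := by
    rw [← hCC, ← hXY, conjTranspose_mul, conjTranspose_conjTranspose]
  -- The component of `Y` orthogonal to `X`, with Gram matrix `1 - C²`; this also forces `c i ≤ 1`.
  set S := Y - X * C with hS
  have hSX : Sᴴ * X = 0 := by
    rw [hS, conjTranspose_sub, conjTranspose_mul, hCC, Matrix.sub_mul, hYX, Matrix.mul_assoc, hX, mul_one,
      sub_self]
  have hSS : Sᴴ * S = diagonal fun i => ((1 - c i ^ 2 : ℝ) : ℂ) := by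
    have : Sᴴ * S = Sᴴ * Y := by
      conv_lhs => rw [hS, Matrix.mul_sub, ← Matrix.mul_assoc, ← hS, hSX, Matrix.zero_mul, sub_zero]
    rw [this, hS, conjTranspose_sub, conjTranspose_mul, hCC, Matrix.sub_mul, hY, Matrix.mul_assoc, hXY,
      hC, diagonal_mul_diagonal, ← diagonal_one, diagonal_sub]
    congr 1
    ext i
    push_cast
    ring
  have hcol : ∀ i, ∑ r, ‖S r i‖ ^ 2 = 1 - c i ^ 2 := fun i => by
    have h := congrFun (congrFun hSS i) i
    rw [diagonal_apply_eq, mul_apply] at h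
    have h2 : ∀ r, Sᴴ i r * S r i = ((‖S r i‖ ^ 2 : ℝ) : ℂ) := fun r => by
      rw [conjTranspose_apply, Complex.star_def, ← Complex.normSq_eq_conj_mul_self,
        Complex.normSq_eq_norm_sq]
    simp only [h2] at h
    exact_mod_cast h
  have hcsq : ∀ i, 0 ≤ 1 - c i ^ 2 := fun i => by rw [← hcol]; positivity
  have hc1 : ∀ i, c i ≤ 1 := fun i => by nlinarith [hcsq i, hc0 i]
  refine ⟨hc1, fun j J hJ => ?_⟩
  let q : Fin k → ℝ := fun i => √(1 - c i ^ 2)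
  have hqsq : ∀ i, q i ^ 2 = 1 - c i ^ 2 := fun i => Real.sq_sqrt (hcsq i)
  -- Normalised columns of `S`. A column with `q i = 0` becomes zero, so `Z` is a contraction but
  -- not always an isometry.
  let Z : Matrix (Fin n) (Fin k) ℂ := of fun r i => ((q i)⁻¹ : ℂ) * S r i
  have hSZ : ∀ r i, S r i = q i * Z r i := fun r i => by
    by_cases hi : q i = 0
    · have h1 : ∑ r, ‖S r i‖ ^ 2 = 0 := by rw [hcol, ← hqsq, hi]; simp
      have h2 := (Finset.sum_eq_zero_iff_of_nonneg fun _ _ => by positivity).1 h1 r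
        (Finset.mem_univ r)
      have h3 : S r i = 0 := by simpa using h2
      simp [h3, hi]
    · have hi' : (q i : ℂ) ≠ 0 := Complex.ofReal_ne_zero.2 hi
      simp only [Z, of_apply]
      field_simp
  have hZZ : Zᴴ * Z = diagonal fun i => (((q i)⁻¹ * q i : ℝ) : ℂ) := by
    ext i l
    have h : (Zᴴ * Z) i l = (q i : ℂ)⁻¹ * (q l : ℂ)⁻¹ * (Sᴴ * S) i l := by
      simp only [mul_apply, Finset.mul_sum, conjTranspose_apply, Z, of_apply, star_mul',
        Complex.star_def, map_inv₀, Complex.conj_ofReal]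
      exact Finset.sum_congr rfl fun r _ => by ring
    rw [h, hSS, diagonal_apply, diagonal_apply]
    split_ifs with hil
    · subst hil
      rw [← hqsq]
      push_cast
      by_cases hi : (q i : ℂ) = 0
      · simp [hi]
      · field_simp
    · simp
  have hZ1 : ‖Z‖ ≤ 1 := norm_le_one_of_conjTranspose_mul_self hZZ fun i => by
    by_cases hi : q i = 0
    · simp [hi]
    · simp [hi]
  have hX1 : ‖X‖ ≤ 1 := norm_le_one_of_conjTranspose_mul_self (d := fun _ => 1)
    (by rw [hX]; simp) (by simp)
  obtain ⟨μ, hμ⟩ := exists_norm_sub_smul_one_le hA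
  set B := A - (μ : ℂ) • (1 : Matrix (Fin n) (Fin n) ℂ) with hB
  have hBh : B.IsHermitian := by
    simp [hB, IsHermitian, conjTranspose_sub, hA.eq, conjTranspose_smul]
  -- The only use of invariance: `A X = X W`, and `S` is orthogonal to `X`.
  have hSBX : Sᴴ * B * X = 0 := by
    rw [hB, Matrix.mul_sub, Matrix.sub_mul, Matrix.mul_assoc, hW, ← Matrix.mul_assoc, hSX]
    simp [hSX]
  have hXBS : Xᴴ * B * S = 0 := by
    have := congrArg conjTranspose hSBX
    simpa [conjTranspose_mul, hBh.eq, Matrix.mul_assoc] using this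
  have hdiff : Yᴴ * A * Y - Xᴴ * A * X =
      C * (Xᴴ * B * X) * C - Xᴴ * B * X + Sᴴ * B * S := by
    have h1 : ∀ P : Matrix (Fin n) (Fin k) ℂ, Pᴴ * P = 1 →
        Pᴴ * B * P = Pᴴ * A * P - (μ : ℂ) • 1 := fun P hP => by
      rw [hB, Matrix.mul_sub, Matrix.sub_mul]
      simp [hP]
    have h2 : Y = X * C + S := by rw [hS]; abel
    have h3 : Yᴴ * B * Y = C * (Xᴴ * B * X) * C + Sᴴ * B * S := by
      have e1 : Yᴴ * B * Y = C * (Xᴴ * B * X) * C + C * (Xᴴ * B * S) + Sᴴ * B * X * C +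
          Sᴴ * B * S := by
        rw [h2, conjTranspose_add, conjTranspose_mul, hCC]
        simp only [Matrix.add_mul, Matrix.mul_add, Matrix.mul_assoc]
        abel
      rw [e1, hXBS, hSBX]
      simp
    have h4 := h1 X hX
    have h5 := h1 Y hY
    rw [h3] at h5
    have h6 : Yᴴ * A * Y = C * (Xᴴ * B * X) * C + Sᴴ * B * S + (μ : ℂ) • 1 := by
      rw [h5]; abel
    rw [h6, h4]
    abel
  have key := sum_abs_eigDesc_sub_le_of_multiplier (isHermitian_conjTranspose_mul_mul X hA)
    (isHermitian_conjTranspose_mul_mul Y hA) (isHermitian_conjTranspose_mul_mul X hBh)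
    (isHermitian_conjTranspose_mul_mul Z hBh) (norm_conjTranspose_mul_mul_le hμ hX1)
    (norm_conjTranspose_mul_mul_le hμ hZ1) hc (q := q)
    (fun i l hil => Real.sqrt_le_sqrt (by nlinarith [hc hil, hc0 i])) hc0 hc1
    (fun i => Real.sqrt_nonneg _) (fun i l => ?_) j J hJ
  · simpa only [hqsq] using key
  · rw [← Matrix.sub_apply, hdiff]
    have h1 : (Sᴴ * B * S) i l = ((q i * q l : ℝ) : ℂ) * (Zᴴ * B * Z) i l := by
      have : S = Z * diagonal fun i => (q i : ℂ) := by
        ext r i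
        rw [mul_diagonal, hSZ, mul_comm]
      rw [this, conjTranspose_mul, (isHermitian_diagonal_ofReal q).eq]
      have e : (diagonal fun i => (q i : ℂ)) * Zᴴ * B * (Z * diagonal fun i => (q i : ℂ)) =
          (diagonal fun i => (q i : ℂ)) * (Zᴴ * B * Z) * diagonal fun i => (q i : ℂ) := by
        simp only [Matrix.mul_assoc]
      rw [e, mul_diagonal, diagonal_mul]
      push_cast
      ring
    rw [Matrix.add_apply, Matrix.sub_apply, h1, hC, mul_diagonal, diagonal_mul]
    push_cast
    ring

/-! ### Weak majorization and the scalar comparison. -/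

lemma sortDesc_of_antitone {y : Fin m → ℝ} (hy : Antitone y) : sortDesc y = y := by
  have h1 : y ∘ (Fin.revPerm : Equiv.Perm (Fin m)) = y ∘ Tuple.sort y :=
    Tuple.comp_sort_eq_comp_iff_monotone.2 (hy.comp fun i j h => Fin.rev_le_rev.2 h)
  funext i
  have := congrFun h1 (Fin.rev i)
  simp only [Function.comp_apply, Fin.revPerm_apply, Fin.rev_rev] at this
  exact this.symm

/-- The `j + 1` largest entries of `x` sit on some index set `J` of that size (indices start at
`0`), so no ordering of `x` itself is needed. -/
lemma weaklyMajorized_of_antitone {x y : Fin m → ℝ} (hy : Antitone y)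
    (h : ∀ (j : Fin m) (J : Finset (Fin m)), J.card = j + 1 →
      ∑ i ∈ J, x i ≤ ∑ i ∈ Finset.Iic j, y i) : WeaklyMajorized x y := by
  intro j
  rw [sortDesc_of_antitone hy]
  have := h j ((Finset.Iic j).map (Fin.revPerm.trans (Tuple.sort x)).toEmbedding) (by simp)
  rw [Finset.sum_map] at this
  exact this

/-- The comparison of the cosine bound with the bound in powers of the squared sine. -/
lemma half_mul_cos_bound_le {s c : ℝ} (hs : 0 ≤ s) (h0 : 0 ≤ c) (h1 : c ≤ 1) :
    s / 2 * (2 * (1 - c) + (1 - c ^ 2)) ≤ s * ((1 - c ^ 2) + 1 / 2 * (1 - c ^ 2) ^ 2) := by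
  have : 2 * (1 - c) + (1 - c ^ 2) ≤ 2 * ((1 - c ^ 2) + 1 / 2 * (1 - c ^ 2) ^ 2) := by
    -- This product is exactly the right side minus the left side.
    have h2 : 0 ≤ c * (1 - c) * ((1 - c) * (2 + c)) := by
      have : 0 ≤ 1 - c := by linarith
      positivity
    nlinarith [h2]
  nlinarith [mul_le_mul_of_nonneg_left this hs]

/-! ### From arbitrary bases to principal position, and the sine bound. -/

/-- The estimate for a pair of subspaces one of which is invariant. -/
theorem sum_abs_eigDesc_sub_le_of_invariant {A : Matrix (Fin n) (Fin n) ℂ} (hA : A.IsHermitian)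
    {𝒳 𝒴 : Submodule ℂ (Fin n → ℂ)} {X Y : Matrix (Fin n) (Fin k) ℂ}
    (hX : IsOrthonormalBasisMatrix X 𝒳) (hY : IsOrthonormalBasisMatrix Y 𝒴)
    (hinv : IsInvariantUnder A 𝒳 ∨ IsInvariantUnder A 𝒴) :
    (∀ i, singDesc (Xᴴ * Y) i ≤ 1) ∧ ∀ (j : Fin k) (J : Finset (Fin k)), J.card = j + 1 →
      ∑ i ∈ J, |eigDesc (isHermitian_conjTranspose_mul_mul X hA) i -
          eigDesc (isHermitian_conjTranspose_mul_mul Y hA) i| ≤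
        ∑ i ∈ Finset.Iic j, spread hA / 2 * (2 * (1 - singDesc (Xᴴ * Y) (Fin.rev i)) +
          (1 - singDesc (Xᴴ * Y) (Fin.rev i) ^ 2)) := by
  obtain ⟨U, V, hU, hV, hUV⟩ := exists_svd (Xᴴ * Y)
  set c : Fin k → ℝ := fun i => singDesc (Xᴴ * Y) (Fin.rev i) with hc
  have hmono : Monotone c := fun i j h =>
    LinearMap.singularValues_antitone _ (Fin.le_def.1 (Fin.rev_le_rev.2 h))
  have hc0 : ∀ i, 0 ≤ c i := fun i => LinearMap.singularValues_nonneg _ _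
  have horth : ∀ {P : Matrix (Fin n) (Fin k) ℂ} {R : Matrix (Fin k) (Fin k) ℂ},
      Pᴴ * P = 1 → Rᴴ * R = 1 → (P * R)ᴴ * (P * R) = 1 := fun {P R} hP hR => by
    rw [conjTranspose_mul, Matrix.mul_assoc, ← Matrix.mul_assoc Pᴴ, hP, one_mul, hR]
  have hinvR : ∀ {P : Matrix (Fin n) (Fin k) ℂ} {R W : Matrix (Fin k) (Fin k) ℂ},
      Rᴴ * R = 1 → A * P = P * W → A * (P * R) = P * R * (Rᴴ * W * R) := fun {P R W} hR h => by
    rw [← Matrix.mul_assoc A, h, Matrix.mul_assoc P R, ← Matrix.mul_assoc R, ← Matrix.mul_assoc R, mul_eq_one_comm.1 hR,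
      one_mul, Matrix.mul_assoc]
  have hXY : (X * U)ᴴ * (Y * V) = diagonal fun i => (c i : ℂ) := by
    rw [← hUV, conjTranspose_mul]
    simp only [Matrix.mul_assoc]
  have hYX : (Y * V)ᴴ * (X * U) = diagonal fun i => (c i : ℂ) := by
    rw [← (isHermitian_diagonal_ofReal c).eq, ← hXY, conjTranspose_mul ((X * U)ᴴ),
      conjTranspose_conjTranspose]
  have hrev : ∀ {f : Fin k → ℝ}, (∀ i, f (Fin.rev i) ≤ 1) → ∀ i, f i ≤ 1 := fun h i => by
    simpa using h (Fin.rev i)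
  rcases hinv with h | h
  · obtain ⟨W, hW⟩ := exists_mul_eq_of_invariant hX.2 h
    obtain ⟨h1, h2⟩ := sum_abs_eigDesc_sub_le_of_principal hA (horth hX.1 hU) (horth hY.1 hV)
      hmono hc0 hXY (hinvR hU hW)
    simp only [eigDesc_conj_mul_right hA X hU, eigDesc_conj_mul_right hA Y hV] at h2
    refine ⟨hrev h1, fun j J hJ => ?_⟩
    simp only [abs_sub_comm (eigDesc (isHermitian_conjTranspose_mul_mul X hA) _)]
    exact h2 j J hJ
  · obtain ⟨W, hW⟩ := exists_mul_eq_of_invariant hY.2 h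
    obtain ⟨h1, h2⟩ := sum_abs_eigDesc_sub_le_of_principal hA (horth hY.1 hV) (horth hX.1 hU)
      hmono hc0 hYX (hinvR hV hW)
    simp only [eigDesc_conj_mul_right hA X hU, eigDesc_conj_mul_right hA Y hV] at h2
    exact ⟨hrev h1, h2⟩

end RitzMajorization

theorem corollary3p4 {n k : ℕ} (A : Matrix (Fin n) (Fin n) ℂ) (hA : A.IsHermitian)
    (𝒳 𝒴 : Submodule ℂ (Fin n → ℂ)) (X Y : Matrix (Fin n) (Fin k) ℂ)
    (hX : IsOrthonormalBasisMatrix X 𝒳) (hY : IsOrthonormalBasisMatrix Y 𝒴)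
    (hinv : IsInvariantUnder A 𝒳 ∨ IsInvariantUnder A 𝒴) :
    WeaklyMajorized
      (fun i => |eigDesc (Matrix.isHermitian_conjTranspose_mul_mul X hA) i -
        eigDesc (Matrix.isHermitian_conjTranspose_mul_mul Y hA) i|)
      (fun i => spread hA * (Real.sin (principalAngles X Y i) ^ 2 +
        1 / 2 * Real.sin (principalAngles X Y i) ^ 4)) ∧
    (∀ i : Fin k,
      spread hA * (Real.sin (principalAngles X Y i) ^ 2 +
        1 / 2 * Real.sin (principalAngles X Y i) ^ 4) ≤
      3 / 2 * spread hA * Real.sin (principalAngles X Y i) ^ 2) ∧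
    WeaklyMajorized
      (fun i => |eigDesc (Matrix.isHermitian_conjTranspose_mul_mul X hA) i -
        eigDesc (Matrix.isHermitian_conjTranspose_mul_mul Y hA) i|)
      (fun i => 3 / 2 * spread hA * Real.sin (principalAngles X Y i) ^ 2) := by
  obtain ⟨h1, h2⟩ := sum_abs_eigDesc_sub_le_of_invariant hA hX hY hinv
  have hs := spread_nonneg hA
  have hmono : Monotone fun i => singDesc (Xᴴ * Y) (Fin.rev i) := fun i j h =>
    LinearMap.singularValues_antitone _ (Fin.le_def.1 (Fin.rev_le_rev.2 h))
  have h0 : ∀ i, 0 ≤ singDesc (Xᴴ * Y) i := fun i => LinearMap.singularValues_nonneg _ _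
  -- The bound `h1` is needed here, to keep the radicand in `sin (arccos x) = √(1 - x²)`
  -- nonnegative.
  have hsin : ∀ i, Real.sin (principalAngles X Y i) ^ 2 =
      1 - singDesc (Xᴴ * Y) (Fin.rev i) ^ 2 := fun i => by
    rw [principalAngles, Real.sin_arccos, Real.sq_sqrt]
    nlinarith [h0 (Fin.rev i), h1 (Fin.rev i)]
  have hanti : Antitone fun i => Real.sin (principalAngles X Y i) ^ 2 := fun i j hij => by
    simp only [hsin]
    have : singDesc (Xᴴ * Y) (Fin.rev i) ≤ singDesc (Xᴴ * Y) (Fin.rev j) := hmono hij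
    nlinarith [h0 (Fin.rev i)]
  have hpow : ∀ i, Real.sin (principalAngles X Y i) ^ 4 =
      (Real.sin (principalAngles X Y i) ^ 2) ^ 2 := fun i => by ring
  have hle : ∀ i : Fin k,
      spread hA * (Real.sin (principalAngles X Y i) ^ 2 +
        1 / 2 * Real.sin (principalAngles X Y i) ^ 4) ≤
      3 / 2 * spread hA * Real.sin (principalAngles X Y i) ^ 2 := fun i => by
    have h3 : Real.sin (principalAngles X Y i) ^ 4 ≤ Real.sin (principalAngles X Y i) ^ 2 := by
      rw [hpow]
      nlinarith [Real.sin_sq_le_one (principalAngles X Y i),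
        sq_nonneg (Real.sin (principalAngles X Y i))]
    nlinarith [mul_le_mul_of_nonneg_left h3 hs]
  have hmain : ∀ (j : Fin k) (J : Finset (Fin k)), J.card = j + 1 →
      ∑ i ∈ J, |eigDesc (Matrix.isHermitian_conjTranspose_mul_mul X hA) i -
          eigDesc (Matrix.isHermitian_conjTranspose_mul_mul Y hA) i| ≤
        ∑ i ∈ Finset.Iic j, spread hA * (Real.sin (principalAngles X Y i) ^ 2 +
          1 / 2 * Real.sin (principalAngles X Y i) ^ 4) := fun j J hJ =>
    (h2 j J hJ).trans (Finset.sum_le_sum fun i _ => by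
      rw [hpow, hsin]
      exact half_mul_cos_bound_le hs (h0 _) (h1 _))
  refine ⟨weaklyMajorized_of_antitone (fun i j hij => ?_) hmain, hle,
    weaklyMajorized_of_antitone (fun i j hij => ?_) fun j J hJ =>
      (hmain j J hJ).trans (Finset.sum_le_sum fun i _ => hle i)⟩
  · have h3 := hanti hij
    simp only [hpow] at h3 ⊢
    gcongr
  · exact mul_le_mul_of_nonneg_left (hanti hij) (by positivity)
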